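/- Theorem 2. A measure preserving system $(X,\mathcal B,\mu,T)$ is a probability space with an invertible (bijective, measurable in both directions) measure preserving transformation $T$. For $1\le r\le\infty$, say that the Return Times for the Tail Property holds in $L^r(\mu)$ for $(X,\mathcal B,\mu,T)$ if for each $f\in L^r(\mu)$ there is a set $X_f\subseteq X$ of full $\mu$-measure such that for all $x\in X_f$, for all measure preserving systems $(Y,\mathcal G,\nu,S)$ and each $g\in L^1(\nu)$, $$\frac{f(T^nx)\,g(S^ny)}{n}\longrightarrow 0\quad (n\to\infty)\qquad\text{for }\nu\text{-a.e. }y\in Y.$$ The Return Times for the Tail Property does not hold in general for $r=1$: there exist a measure preserving system $(X,\mathcal B,\mu,T)$ and a real-valued $f\in L^1(\mu)$ for which there is no set $X_f$ of full $\mu$-measure as above. -/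

import Mathlib

open MeasureTheory Filter Topology
open scoped ENNReal

/-- The Return Times for the Tail Property in `L^r(μ)` (for `1 ≤ r ≤ ∞`) of the invertible
probability measure preserving system `(X, μ, T)`: for every `f ∈ L^r(μ)` there is a set of full
`μ`-measure such that, for every `x` in it, every invertible probability measure preserving system
`(Y, ν, S)` and every `g ∈ L^1(ν)`, one has `f (T^n x) * g (S^n y) / n → 0` for `ν`-a.e. `y`.
The exceptional set depends only on `f`. -/
def ReturnTimesForTheTail {X : Type} [MeasurableSpace X] (μ : Measure X) (T : X ≃ᵐ X)
    (r : ℝ≥0∞) : Prop :=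
  ∀ f : X → ℝ, MemLp f r μ →
    ∀ᵐ x ∂μ, ∀ (Y : Type) [MeasurableSpace Y] (ν : Measure Y) [IsProbabilityMeasure ν]
      (S : Y ≃ᵐ Y), MeasurePreserving S ν ν →
      ∀ g : Y → ℝ, Integrable g ν →
        ∀ᵐ y ∂ν, Tendsto (fun n : ℕ => f (T^[n] x) * g (S^[n] y) / (n : ℝ)) atTop (𝓝 0)

/-!
For a sequence `a`, consider `countMax a`, the supremum over `t` of `#{n | a n / n ≥ 1 / t} / t`.
If it is infinite, then some integrable function `g` on `[0, 1]`, with a tail adapted to a sequence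
of scales `t`, has `∑ n, vol {a n * g / n ≥ 1} = ∞`, so by the second Borel–Cantelli lemma
independent copies of `g` give `a n * g (S^n y) / n ≥ 1` infinitely often for a.e. `y`. It remains
to find an integrable `f` whose orbit sequences `n ↦ f (T^n x)` have this property for a.e. `x`;
that they exist at all is the phenomenon of Assani, Buczolich and Mauldin.

By Borel–Cantelli in a product of cyclic rotations it is enough to find periodic `f ≥ 0` of mean at
most `1` with `countMax ≥ K` at half of the points, for every `K`. Say that the *loss* of `f` at `x`
at scale `t` is `exp (-#hits / t)`. When a long stretch of a function `f` is followed by a long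
stretch of `g`, with spikes of height `2 ^ γ` far above the values of `f`, the points of `f` hit
these spikes in addition to their own values; the spikes have density `d`, so the loss is multiplied
by `exp (-2 ^ γ * d / 4)`, up to a small proportion of points near the boundary. Start from
`g = 2 ^ γ` on the multiples of `2 ^ γ`, which has mean `1` and `2 ^ γ * d = 1`. Putting `f` in
front `n` times halves the density and the weight of the initial `g` at each step: its contribution
to mean and loss drops to `2 ^ (-n)`, whereas each of the `n` steps lowers the final mean loss by at
least `2 ^ (-n) / 8` times the loss of `f`. So the loss decreases by a factor `1 - n * 2 ^ (-n) / 8`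
at the cost of `2 ^ (-n)` in the mean, and `2 ^ n` repetitions lead from mean `0` and loss `1` to
mean `1` and loss `O (1 / n)`.
-/

open Finset (range)
open ProbabilityTheory (uniformOn)
open scoped BigOperators

/-! ### Periodic functions -/

section Periodic

variable {M : Type*} [AddCommMonoid M] {φ : ℕ → M} {P : ℕ}

lemma sum_range_add_of_periodic (hφ : Function.Periodic φ P) (a : ℕ) :
    ∑ i ∈ range P, φ (a + i) = ∑ i ∈ range P, φ i := by
  induction a with
  | zero => simp only [zero_add]
  | succ a ih =>
    rw [← ih]
    cases P with
    | zero => rfl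
    | succ p =>
      rw [Finset.sum_range_succ, Finset.sum_range_succ', add_right_comm a 1 p, add_assoc a p 1,
        hφ a]
      simp only [add_zero, add_right_comm a 1, ← add_assoc]

lemma sum_range_mul_of_periodic (hφ : Function.Periodic φ P) (q a : ℕ) :
    ∑ i ∈ range (q * P), φ (a + i) = q • ∑ i ∈ range P, φ i := by
  induction q with
  | zero => simp
  | succ q ih =>
    rw [Nat.succ_mul, Finset.sum_range_add, ih, succ_nsmul]
    simp only [← add_assoc]
    rw [sum_range_add_of_periodic hφ]

lemma expect_range_of_periodic [Module ℚ≥0 M] (hφ : Function.Periodic φ P) {Q : ℕ} (hPQ : P ∣ Q)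
    (hQ : Q ≠ 0) (a : ℕ) : 𝔼 i ∈ range Q, φ (a + i) = 𝔼 i ∈ range P, φ i := by
  obtain ⟨q, rfl⟩ := hPQ
  have hq : (q : ℚ≥0) ≠ 0 := by exact_mod_cast right_ne_zero_of_mul hQ
  simp only [Finset.expect, Finset.card_range]
  rw [mul_comm P q, sum_range_mul_of_periodic hφ, ← Nat.cast_smul_eq_nsmul ℚ≥0, smul_smul,
    Nat.cast_mul, mul_inv_rev, inv_mul_cancel_right₀ hq]

end Periodic

lemma periodic_of_dvd {α : Type*} {f : ℕ → α} {P Q : ℕ} (hf : Function.Periodic f P)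
    (hPQ : P ∣ Q) : Function.Periodic f Q := by
  obtain ⟨q, rfl⟩ := hPQ
  simpa [mul_comm] using hf.nat_mul q

lemma mul_expect_range_le_of_periodic {φ : ℕ → ℝ} {P N : ℕ} (hφ : Function.Periodic φ P)
    (hφ0 : ∀ i, 0 ≤ φ i) (hPN : P ≤ N) (a : ℕ) :
    N * 𝔼 i ∈ range P, φ i ≤ 2 * ∑ i ∈ range N, φ (a + i) := by
  rcases P.eq_zero_or_pos with rfl | hP
  · simpa using Finset.sum_nonneg fun i _ => hφ0 (a + i)
  have hN : N ≤ 2 * (N / P * P) := by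
    have hdiv := Nat.div_add_mod' N P
    have hmod := Nat.mod_lt N hP
    have hone := Nat.mul_le_mul_right P (Nat.div_pos hPN hP)
    omega
  calc N * 𝔼 i ∈ range P, φ i ≤ (2 * (N / P * P) : ℕ) * 𝔼 i ∈ range P, φ i := by
        have := Finset.expect_nonneg (s := range P) fun i _ => hφ0 i
        gcongr
    _ = 2 * ((N / P : ℕ) * ∑ i ∈ range P, φ i) := by
        rw [← Finset.card_mul_expect, Finset.card_range]
        push_cast
        ring
    _ = 2 * ∑ i ∈ range (N / P * P), φ (a + i) := by
        rw [sum_range_mul_of_periodic hφ, nsmul_eq_mul]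
    _ ≤ 2 * ∑ i ∈ range N, φ (a + i) := by
        gcongr
        · exact fun i _ _ => hφ0 _
        · exact Nat.div_mul_le_self N P

lemma expect_range_two_mul (φ : ℕ → ℝ) (H : ℕ) :
    𝔼 x ∈ range (2 * H), φ x = (𝔼 x ∈ range H, φ x + 𝔼 x ∈ range H, φ (H + x)) / 2 := by
  simp only [Finset.expect_eq_sum_div_card, Finset.card_range, two_mul H, Finset.sum_range_add]
  push_cast
  ring

/-- The function of period `2 * H` that follows `u` on `[0, H)` and `v` on `[H, 2 * H)`. It
glues two towers with periods dividing `H`. -/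
def splice {α : Type*} (H : ℕ) (u v : ℕ → α) (x : ℕ) : α :=
  if x % (2 * H) < H then u x else v x

section Splice

variable {α : Type*} {H : ℕ} {u v : ℕ → α}

lemma splice_of_mod_lt {x : ℕ} (hx : x % (2 * H) < H) : splice H u v x = u x := if_pos hx

lemma splice_of_le_mod {x : ℕ} (hx : H ≤ x % (2 * H)) : splice H u v x = v x :=
  if_neg hx.not_gt

lemma splice_of_lt {x : ℕ} (hx : x < H) : splice H u v x = u x :=
  splice_of_mod_lt (by rwa [Nat.mod_eq_of_lt (by omega)])

lemma splice_add_of_lt {x : ℕ} (hx : x < H) : splice H u v (H + x) = v (H + x) :=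
  splice_of_le_mod (by rw [Nat.mod_eq_of_lt (by omega)]; omega)

lemma splice_periodic (hu : Function.Periodic u (2 * H)) (hv : Function.Periodic v (2 * H)) :
    Function.Periodic (splice H u v) (2 * H) := fun x => by
  simp only [splice, Nat.add_mod_right, hu x, hv x]

lemma forall_splice {p : α → Prop} (hu : ∀ x, p (u x)) (hv : ∀ x, p (v x)) (x : ℕ) :
    p (splice H u v x) := by
  unfold splice
  split_ifs
  exacts [hu x, hv x]

lemma expect_splice (φ : α → ℝ) {P Q : ℕ} (hu : Function.Periodic u P)
    (hv : Function.Periodic v Q) (hP : P ∣ H) (hQ : Q ∣ H) (hH : H ≠ 0) :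
    𝔼 x ∈ range (2 * H), φ (splice H u v x) =
      (𝔼 x ∈ range P, φ (u x) + 𝔼 x ∈ range Q, φ (v x)) / 2 := by
  have hleft : 𝔼 x ∈ range H, φ (splice H u v x) = 𝔼 x ∈ range P, φ (u x) :=
    calc 𝔼 x ∈ range H, φ (splice H u v x) = 𝔼 x ∈ range H, φ (u (0 + x)) :=
          Finset.expect_congr rfl fun x hx => by rw [splice_of_lt (Finset.mem_range.1 hx), zero_add]
      _ = _ := expect_range_of_periodic (hu.comp φ) hP hH 0
  have hright : 𝔼 x ∈ range H, φ (splice H u v (H + x)) = 𝔼 x ∈ range Q, φ (v x) :=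
    calc 𝔼 x ∈ range H, φ (splice H u v (H + x)) = 𝔼 x ∈ range H, φ (v (H + x)) :=
          Finset.expect_congr rfl fun x hx => by rw [splice_add_of_lt (Finset.mem_range.1 hx)]
      _ = _ := expect_range_of_periodic (hv.comp φ) hQ hH H
  rw [expect_range_two_mul, hleft, hright]

end Splice

/-! ### The counting maximal function -/

/-- The times `n ≥ 1` at which `a n / n ≥ 1 / t`, written without division. -/
def hitTimes (a : ℕ → ℝ) (t : ℕ) : Set ℕ := {n | 1 ≤ n ∧ (n : ℝ) ≤ t * a n}

/-- The counting maximal function `sup_t #{n | a n / n ≥ 1 / t} / t` of a sequence. The term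
`t = 0` is harmless, as it is `0 / 0 = 0`. -/
noncomputable def countMax (a : ℕ → ℝ) : ℝ≥0∞ := ⨆ t : ℕ, (hitTimes a t).encard / t

/-- The hit times of a height function `f` seen from the point `x`. -/
def hitTimesFrom (f : ℕ → ℕ) (x t : ℕ) : Set ℕ := hitTimes (fun n => f (x + n)) t

/-- The loss `exp (-#hits / t)` at `x` of the time scale `t x` for the sequence `f (x + ·)`: it is
small where the counting maximal function is large, and a gain of hits acts on it
multiplicatively. -/
noncomputable def hitLoss (f t : ℕ → ℕ) (x : ℕ) : ℝ :=
  Real.exp (-((hitTimesFrom f x (t x)).ncard / t x))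

lemma hitTimes_mono {a b : ℕ → ℝ} {s t : ℕ} (h : ∀ n ∈ hitTimes a s, s * a n ≤ t * b n) :
    hitTimes a s ⊆ hitTimes b t := fun n hn => ⟨hn.1, hn.2.trans (h n hn)⟩

lemma hitTimes_finite {a : ℕ → ℝ} {B : ℝ} (ha : ∀ n, a n ≤ B) (t : ℕ) : (hitTimes a t).Finite :=
  (Set.finite_Iic ⌊t * B⌋₊).subset fun n hn =>
    Nat.le_floor (hn.2.trans (mul_le_mul_of_nonneg_left (ha n) t.cast_nonneg))

lemma countMax_le_mul {a b : ℕ → ℝ} {k : ℕ} (hk : 0 < k) (h : ∀ n, b n ≤ k * a n) :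
    countMax b ≤ k * countMax a := by
  refine iSup_le fun t => ?_
  have hsub : hitTimes b t ⊆ hitTimes a (k * t) := hitTimes_mono fun n _ => by
    rw [Nat.cast_mul, mul_comm (k : ℝ), mul_assoc]
    exact mul_le_mul_of_nonneg_left (h n) t.cast_nonneg
  calc ((hitTimes b t).encard : ℝ≥0∞) / t ≤ (hitTimes a (k * t)).encard / t := by
        gcongr
    _ = k * ((hitTimes a (k * t)).encard / (k * t : ℕ)) := by
        rw [Nat.cast_mul, ← mul_div_assoc,
          ENNReal.mul_div_mul_left _ _ (by simp [hk.ne']) (by simp)]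
    _ ≤ k * countMax a := by
        gcongr
        exact le_iSup (fun s : ℕ => ((hitTimes a s).encard : ℝ≥0∞) / s) (k * t)

lemma exists_mul_le_encard_hitTimes {a : ℕ → ℝ} {K : ℝ≥0∞} (hK : K < countMax a) :
    ∃ t : ℕ, 0 < t ∧ K * t ≤ (hitTimes a t).encard := by
  obtain ⟨t, ht⟩ := lt_iSup_iff.1 hK
  have ht0 : t ≠ 0 := by
    rintro rfl
    have hempty : hitTimes a 0 = ∅ := Set.eq_empty_of_forall_notMem fun n hn => by
      have hle := hn.2
      rw [Nat.cast_zero, zero_mul] at hle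
      exact absurd hn.1 (by simpa using hle)
    simp [hempty] at ht
  refine ⟨t, Nat.pos_of_ne_zero ht0, ?_⟩
  rw [← ENNReal.le_div_iff_mul_le (by simp [ht0]) (by simp)]
  exact ht.le

lemma mem_hitTimesFrom {f : ℕ → ℕ} {x t n : ℕ} :
    n ∈ hitTimesFrom f x t ↔ 1 ≤ n ∧ n ≤ t * f (x + n) := by
  simp only [hitTimesFrom, hitTimes, Set.mem_ofPred_eq]
  norm_cast

lemma hitTimesFrom_finite {f : ℕ → ℕ} {B : ℕ} (hf : ∀ y, f y ≤ B) (x t : ℕ) :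
    (hitTimesFrom f x t).Finite :=
  hitTimes_finite (B := B) (fun n => by exact_mod_cast hf (x + n)) t

lemma hitLoss_le_one (f t : ℕ → ℕ) (x : ℕ) : hitLoss f t x ≤ 1 :=
  Real.exp_le_one_iff.2 (neg_nonpos.2 (by positivity))

lemma hitLoss_periodic {f t : ℕ → ℕ} {P : ℕ} (hf : Function.Periodic f P)
    (ht : Function.Periodic t P) : Function.Periodic (hitLoss f t) P := fun x => by
  simp only [hitLoss, hitTimesFrom, ht x, add_right_comm x P, hf _]

lemma hitLoss_le_exp_mul {f g s t : ℕ → ℕ} {x : ℕ} {κ : ℝ} (hst : s x = t x) (ht : 0 < t x)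
    (h : (hitTimesFrom f x (t x)).ncard + t x * κ ≤
      (hitTimesFrom g x (t x)).ncard) :
    hitLoss g s x ≤ Real.exp (-κ) * hitLoss f t x := by
  have ht' : (0 : ℝ) < t x := by exact_mod_cast ht
  rw [hitLoss, hitLoss, ← Real.exp_add, Real.exp_le_exp, hst, ← neg_add, neg_le_neg_iff,
    le_div_iff₀ ht', add_mul, div_mul_cancel₀ _ ht'.ne']
  linarith

/-! ### Towers -/

/-- At scale `2 ^ r`, a height function `f` with a time scale `t x` at every point `x`: both are
`2 ^ r`-periodic, `f` has mean at most `m`, the mean loss is at most `α`, and `C` bounds the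
height and the ratio of the time scales to `2 ^ r`. -/
structure IsTower (C r : ℕ) (m α : ℝ) (f t : ℕ → ℕ) : Prop where
  periodic : Function.Periodic f (2 ^ r)
  periodic_time : Function.Periodic t (2 ^ r)
  le_pow : ∀ x, f x ≤ 2 ^ C
  pow_le_time : ∀ x, 2 ^ r ≤ 2 ^ C * t x
  time_le : ∀ x, t x ≤ 2 ^ (r + C)
  mean_le : 𝔼 x ∈ range (2 ^ r), (f x : ℝ) ≤ m
  loss_le : 𝔼 x ∈ range (2 ^ r), hitLoss f t x ≤ α

namespace IsTower

variable {C r : ℕ} {m α : ℝ} {f t : ℕ → ℕ}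

lemma time_pos (h : IsTower C r m α f t) (x : ℕ) : 0 < t x :=
  Nat.pos_of_ne_zero fun h0 => by simpa [h0] using h.pow_le_time x

lemma le_of_mem_hitTimes (h : IsTower C r m α f t) {x n : ℕ}
    (hn : n ∈ hitTimesFrom f x (t x)) : n ≤ 2 ^ (r + 2 * C) :=
  calc n ≤ t x * f (x + n) := (mem_hitTimesFrom.1 hn).2
    _ ≤ 2 ^ (r + C) * 2 ^ C := Nat.mul_le_mul (h.time_le x) (h.le_pow _)
    _ = 2 ^ (r + 2 * C) := by ring

lemma pow_le_two_pow_mul_time (h : IsTower C r m α f t) {k : ℕ} (hk : C ≤ k) (x : ℕ) :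
    2 ^ (r + (k - C)) ≤ 2 ^ k * t x := by
  calc 2 ^ (r + (k - C)) = 2 ^ (k - C) * 2 ^ r := by ring
    _ ≤ 2 ^ (k - C) * (2 ^ C * t x) := Nat.mul_le_mul_left _ (h.pow_le_time x)
    _ = 2 ^ k * t x := by rw [← mul_assoc, ← pow_add, Nat.sub_add_cancel hk]

lemma mono {m' α' : ℝ} (h : IsTower C r m α f t) (hm : m ≤ m') (hα : α ≤ α') :
    IsTower C r m' α' f t where
  __ := h
  mean_le := h.mean_le.trans hm
  loss_le := h.loss_le.trans hα

end IsTower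

lemma mul_div_four_le_card_far {g : ℕ → ℕ} {H N c : ℕ} {d : ℝ}
    (hg : Function.Periodic g (2 * H)) (hN : 2 * H ≤ N)
    (hd : d ≤ 𝔼 i ∈ range H, if c ≤ g (H + i) then (1 : ℝ) else 0) (x : ℕ) :
    N * d / 4 ≤ (Finset.card {n ∈ Finset.Icc 1 N | H ≤ (x + n) % (2 * H) ∧ c ≤ g (x + n)}) := by
  set φ : ℕ → ℝ := fun y => if H ≤ y % (2 * H) ∧ c ≤ g y then 1 else 0 with hφ
  have hφ0 : ∀ y, 0 ≤ φ y := fun y => by simp only [hφ]; split_ifs <;> norm_num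
  have hper : Function.Periodic φ (2 * H) := fun y => by
    simp only [hφ, Nat.add_mod_right, hg y]
  have hmean : d / 2 ≤ 𝔼 y ∈ range (2 * H), φ y := by
    have hsecond : 𝔼 i ∈ range H, φ (H + i) =
        𝔼 i ∈ range H, if c ≤ g (H + i) then (1 : ℝ) else 0 :=
      Finset.expect_congr rfl fun i hi => by
        have := Finset.mem_range.1 hi
        simp only [hφ, Nat.mod_eq_of_lt (show H + i < 2 * H by omega), Nat.le_add_right, true_and]
    have hfirst : 0 ≤ 𝔼 i ∈ range H, φ i := Finset.expect_nonneg fun i _ => hφ0 i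
    rw [expect_range_two_mul, hsecond]
    linarith
  have hcard : ∑ i ∈ range N, φ (x + 1 + i) =
      Finset.card {n ∈ Finset.Icc 1 N | H ≤ (x + n) % (2 * H) ∧ c ≤ g (x + n)} :=
    calc ∑ i ∈ range N, φ (x + 1 + i) = ∑ i ∈ Finset.Ico 0 N, φ (x + (i + 1)) := by
          simp only [Finset.range_eq_Ico, add_assoc, add_comm 1]
      _ = ∑ n ∈ Finset.Ico (0 + 1) (N + 1), φ (x + n) :=
          Finset.sum_Ico_add' (fun n => φ (x + n)) 0 N 1
      _ = _ := by rw [Finset.natCast_card_filter, zero_add, Finset.Ico_add_one_right_eq_Icc]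
  have := mul_expect_range_le_of_periodic hper hφ0 hN (x + 1)
  rw [← hcard]
  have := mul_le_mul_of_nonneg_left hmean N.cast_nonneg (α := ℝ)
  linarith

lemma ncard_add_le_ncard_hitTimes_splice {f g : ℕ → ℕ} {H τ c x : ℕ} {d : ℝ}
    (hfin : (hitTimesFrom (splice H f g) x τ).Finite)
    (hnear : ∀ n ∈ hitTimesFrom f x τ, x + n < H)
    (hg : Function.Periodic g (2 * H)) (hτ : 2 * H ≤ τ * c)
    (hd : d ≤ 𝔼 i ∈ range H, if c ≤ g (H + i) then (1 : ℝ) else 0) :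
    (hitTimesFrom f x τ).ncard + τ * (c * d / 4) ≤
      ((hitTimesFrom (splice H f g) x τ).ncard : ℝ) := by
  set near := hitTimesFrom f x τ
  set far : Finset ℕ := {n ∈ Finset.Icc 1 (τ * c) | H ≤ (x + n) % (2 * H) ∧ c ≤ g (x + n)}
  have hnear_sub : near ⊆ hitTimesFrom (splice H f g) x τ :=
    fun n hn => by
      rw [mem_hitTimesFrom, splice_of_lt (hnear n hn)]
      exact mem_hitTimesFrom.1 hn
  have hfar_sub : (far : Set ℕ) ⊆ hitTimesFrom (splice H f g) x τ := by
    intro n hn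
    obtain ⟨hn1, hmod, hc⟩ := Finset.mem_filter.1 hn
    obtain ⟨hpos, hle⟩ := Finset.mem_Icc.1 hn1
    rw [mem_hitTimesFrom, splice_of_le_mod hmod]
    exact ⟨hpos, hle.trans (Nat.mul_le_mul_left τ hc)⟩
  have hdisj : Disjoint near (far : Set ℕ) := Set.disjoint_left.2 fun n hn hn' => by
    have hlt := hnear n hn
    have hmod := (Finset.mem_filter.1 hn').2.1
    rw [Nat.mod_eq_of_lt (by omega)] at hmod
    omega
  have hcard : near.ncard + far.card ≤ (hitTimesFrom (splice H f g) x τ).ncard := by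
    rw [← Set.ncard_coe_finset far, ← Set.ncard_union_eq hdisj (hfin.subset hnear_sub)]
    exact Set.ncard_le_ncard (Set.union_subset hnear_sub hfar_sub) hfin
  have hfar_card := mul_div_four_le_card_far hg hτ hd x
  calc (near.ncard : ℝ) + τ * (c * d / 4) = near.ncard + (τ * c : ℕ) * d / 4 := by push_cast; ring
    _ ≤ near.ncard + far.card := by gcongr
    _ ≤ _ := by exact_mod_cast hcard

section HitLossSplice

variable {f g s t : ℕ → ℕ} {H W x : ℕ}

lemma hitLoss_splice_le {c : ℕ} {d : ℝ}
    (hfin : (hitTimesFrom (splice H f g) x (t x)).Finite) (hx : x < H)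
    (hW : ∀ n ∈ hitTimesFrom f x (t x), n ≤ W) (hg : Function.Periodic g (2 * H))
    (ht : 2 * H ≤ t x * c) (hd : d ≤ 𝔼 i ∈ range H, if c ≤ g (H + i) then (1 : ℝ) else 0) :
    hitLoss (splice H f g) (splice H t s) x ≤
      Real.exp (-(c * d / 4)) * hitLoss f t x + if H ≤ x + W then 1 else 0 := by
  split_ifs with hxW
  · exact (hitLoss_le_one _ _ x).trans
      (le_add_of_nonneg_left (mul_nonneg (Real.exp_pos _).le (Real.exp_pos _).le))
  · rw [add_zero]
    have htpos : 0 < t x := Nat.pos_of_ne_zero fun h0 => by rw [h0] at ht; omega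
    refine hitLoss_le_exp_mul (splice_of_lt hx) htpos
      (ncard_add_le_ncard_hitTimes_splice hfin (fun n hn => ?_) hg ht hd)
    have := hW n hn
    omega

lemma hitLoss_splice_add_le
    (hfin : (hitTimesFrom (splice H f g) (H + x) (s (H + x))).Finite) (hx : x < H)
    (hW : ∀ n ∈ hitTimesFrom g (H + x) (s (H + x)), n ≤ W) (hs : 0 < s (H + x)) :
    hitLoss (splice H f g) (splice H t s) (H + x) ≤
      hitLoss g s (H + x) + if H ≤ x + W then 1 else 0 := by
  split_ifs with hxW
  · exact (hitLoss_le_one _ _ _).trans (le_add_of_nonneg_left (Real.exp_pos _).le)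
  · have hsub : hitTimesFrom g (H + x) (s (H + x)) ⊆
        hitTimesFrom (splice H f g) (H + x) (s (H + x)) := fun n hn => by
      have := hW n hn
      rw [mem_hitTimesFrom, add_assoc, splice_add_of_lt (by omega), ← add_assoc]
      exact mem_hitTimesFrom.1 hn
    have hcard := Set.ncard_le_ncard hsub hfin
    have := hitLoss_le_exp_mul (f := g) (t := s) (κ := 0) (splice_add_of_lt (u := t) hx) hs
      (by simpa using hcard)
    simpa using this

end HitLossSplice

lemma expect_range_boundary_le (k h : ℕ) :
    𝔼 x ∈ range (2 ^ (k + h)), (if 2 ^ (k + h) ≤ x + 2 ^ k then (1 : ℝ) else 0) ≤ (1 / 2) ^ h := by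
  have hsub : {x ∈ range (2 ^ (k + h)) | 2 ^ (k + h) ≤ x + 2 ^ k} ⊆
      Finset.Ico (2 ^ (k + h) - 2 ^ k) (2 ^ (k + h)) := fun x hx => by
    simp only [Finset.mem_filter, Finset.mem_range] at hx
    exact Finset.mem_Ico.2 (by omega)
  have hle : 2 ^ k ≤ 2 ^ (k + h) := Nat.pow_le_pow_right two_pos (Nat.le_add_right k h)
  have hcard : Finset.card {x ∈ range (2 ^ (k + h)) | 2 ^ (k + h) ≤ x + 2 ^ k} ≤ 2 ^ k :=
    (Finset.card_le_card hsub).trans_eq (by rw [Nat.card_Ico, Nat.sub_sub_self hle])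
  rw [Finset.expect_eq_sum_div_card, Finset.card_range, ← Finset.natCast_card_filter]
  calc (Finset.card {x ∈ range (2 ^ (k + h)) | 2 ^ (k + h) ≤ x + 2 ^ k} : ℝ) / (2 ^ (k + h) : ℕ)
      ≤ (2 ^ k : ℕ) / (2 ^ (k + h) : ℕ) := by gcongr
    _ = (1 / 2) ^ h := by
      push_cast
      rw [pow_add, div_mul_cancel_left₀ (by positivity), one_div, inv_pow]

section SpliceTowers

variable {CA CB rA rB R γ h : ℕ} {d m m' α β : ℝ} {f g t s : ℕ → ℕ}

lemma hitTimesFrom_splice_finite (hf : IsTower CA rA m α f t) (hg : IsTower CB rB m' β g s)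
    (H x τ : ℕ) : (hitTimesFrom (splice H f g) x τ).Finite :=
  hitTimesFrom_finite (forall_splice (p := (· ≤ max (2 ^ CA) (2 ^ CB)))
    (fun y => le_max_of_le_left (hf.le_pow y)) fun y => le_max_of_le_right (hg.le_pow y)) x τ

lemma expect_hitLoss_splice_le (hf : IsTower CA rA m α f t) (hg : IsTower CB rB m' β g s)
    (hd : d ≤ 𝔼 x ∈ range (2 ^ rB), if 2 ^ γ ≤ g x then (1 : ℝ) else 0)
    (hA : rA + 2 * CA + h = R) (hB : rB ≤ R) (hγ : 3 * CA + h + 1 ≤ γ) :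
    𝔼 x ∈ range (2 ^ R), hitLoss (splice (2 ^ R) f g) (splice (2 ^ R) t s) x ≤
      Real.exp (-(2 ^ γ * d / 4)) * α + (1 / 2) ^ h := by
  have hgper := periodic_of_dvd hg.periodic ((pow_dvd_pow 2 hB).mul_left 2)
  have hdens : d ≤ 𝔼 i ∈ range (2 ^ R), if 2 ^ γ ≤ g (2 ^ R + i) then (1 : ℝ) else 0 :=
    hd.trans_eq (expect_range_of_periodic
      (hg.periodic.comp fun n => if 2 ^ γ ≤ n then (1 : ℝ) else 0)
      (pow_dvd_pow 2 hB) (by positivity) (2 ^ R)).symm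
  have htime : ∀ x, 2 * 2 ^ R ≤ t x * 2 ^ γ := fun x => by
    rw [← pow_succ', mul_comm (t x)]
    refine le_trans ?_ (hf.pow_le_two_pow_mul_time (k := γ) (by omega) x)
    exact Nat.pow_le_pow_right two_pos (by omega)
  have hloss : 𝔼 x ∈ range (2 ^ R), hitLoss f t x ≤ α := by
    have := expect_range_of_periodic (hitLoss_periodic hf.periodic hf.periodic_time)
      (pow_dvd_pow 2 (show rA ≤ R by omega)) (by positivity) 0
    simp only [zero_add] at this
    exact this.trans_le hf.loss_le
  calc 𝔼 x ∈ range (2 ^ R), hitLoss (splice (2 ^ R) f g) (splice (2 ^ R) t s) x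
      ≤ 𝔼 x ∈ range (2 ^ R), (Real.exp (-((2 ^ γ : ℕ) * d / 4)) * hitLoss f t x +
          if 2 ^ R ≤ x + 2 ^ (rA + 2 * CA) then 1 else 0) :=
        Finset.expect_le_expect fun x hx =>
          hitLoss_splice_le (hitTimesFrom_splice_finite hf hg _ x _) (Finset.mem_range.1 hx)
            (fun n => hf.le_of_mem_hitTimes) hgper (htime x) hdens
    _ ≤ Real.exp (-(2 ^ γ * d / 4)) * α + (1 / 2) ^ h := by
      rw [Finset.expect_add_distrib, ← Finset.mul_expect, Nat.cast_pow, Nat.cast_ofNat]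
      gcongr
      exact hA ▸ expect_range_boundary_le _ _

lemma expect_hitLoss_splice_add_le (hf : IsTower CA rA m α f t) (hg : IsTower CB rB m' β g s)
    (hB : rB + 2 * CB + h = R) :
    𝔼 x ∈ range (2 ^ R), hitLoss (splice (2 ^ R) f g) (splice (2 ^ R) t s) (2 ^ R + x) ≤
      β + (1 / 2) ^ h := by
  have hloss : 𝔼 x ∈ range (2 ^ R), hitLoss g s (2 ^ R + x) ≤ β :=
    (expect_range_of_periodic (hitLoss_periodic hg.periodic hg.periodic_time)
      (pow_dvd_pow 2 (show rB ≤ R by omega)) (by positivity) _).trans_le hg.loss_le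
  calc 𝔼 x ∈ range (2 ^ R), hitLoss (splice (2 ^ R) f g) (splice (2 ^ R) t s) (2 ^ R + x)
      ≤ 𝔼 x ∈ range (2 ^ R), (hitLoss g s (2 ^ R + x) +
          if 2 ^ R ≤ x + 2 ^ (rB + 2 * CB) then 1 else 0) :=
        Finset.expect_le_expect fun x hx =>
          hitLoss_splice_add_le (hitTimesFrom_splice_finite hf hg _ _ _) (Finset.mem_range.1 hx)
            (fun n => hg.le_of_mem_hitTimes) (hg.time_pos _)
    _ ≤ β + (1 / 2) ^ h := by
      rw [Finset.expect_add_distrib]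
      exact add_le_add hloss (hB ▸ expect_range_boundary_le _ _)

lemma isTower_splice (hf : IsTower CA rA m α f t) (hg : IsTower CB rB m' β g s)
    (hd : d ≤ 𝔼 x ∈ range (2 ^ rB), if 2 ^ γ ≤ g x then (1 : ℝ) else 0)
    (hA : rA + 2 * CA + h = R) (hB : rB + 2 * CB + h = R) (hγ : 3 * CA + h + 1 ≤ γ) :
    IsTower (3 * (CA + CB) + h + 1) (R + 1) ((m + m') / 2)
      ((Real.exp (-(2 ^ γ * d / 4)) * α + β) / 2 + (1 / 2) ^ h)
      (splice (2 ^ R) f g) (splice (2 ^ R) t s) := by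
  have hdA : 2 ^ rA ∣ 2 ^ R := pow_dvd_pow 2 (by omega)
  have hdB : 2 ^ rB ∣ 2 ^ R := pow_dvd_pow 2 (by omega)
  have hR : 2 ^ (R + 1) = 2 * 2 ^ R := pow_succ' 2 R
  have hR0 : 2 ^ R ≠ 0 := by positivity
  refine ⟨?_, ?_, ?_, ?_, ?_, ?_, ?_⟩
  · exact hR ▸ splice_periodic (periodic_of_dvd hf.periodic (hdA.mul_left 2))
      (periodic_of_dvd hg.periodic (hdB.mul_left 2))
  · exact hR ▸ splice_periodic (periodic_of_dvd hf.periodic_time (hdA.mul_left 2))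
      (periodic_of_dvd hg.periodic_time (hdB.mul_left 2))
  · exact forall_splice (p := (· ≤ _))
      (fun x => (hf.le_pow x).trans (Nat.pow_le_pow_right two_pos (by omega)))
      fun x => (hg.le_pow x).trans (Nat.pow_le_pow_right two_pos (by omega))
  · refine forall_splice (p := fun τ => 2 ^ (R + 1) ≤ 2 ^ (3 * (CA + CB) + h + 1) * τ)
      (fun x => ?_) fun x => ?_
    · refine le_trans ?_ (hf.pow_le_two_pow_mul_time (by omega) x)
      exact Nat.pow_le_pow_right two_pos (by omega)
    · refine le_trans ?_ (hg.pow_le_two_pow_mul_time (by omega) x)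
      exact Nat.pow_le_pow_right two_pos (by omega)
  · exact forall_splice (p := (· ≤ _))
      (fun x => (hf.time_le x).trans (Nat.pow_le_pow_right two_pos (by omega)))
      fun x => (hg.time_le x).trans (Nat.pow_le_pow_right two_pos (by omega))
  · rw [hR, expect_splice (fun n : ℕ => (n : ℝ)) hf.periodic hg.periodic hdA hdB hR0]
    linarith [hf.mean_le, hg.mean_le]
  · rw [hR, expect_range_two_mul]
    linarith [expect_hitLoss_splice_le (s := s) hf hg hd hA (by omega) hγ,
      expect_hitLoss_splice_add_le (t := t) hf hg hB]

end SpliceTowers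

/-! ### Towers of mean one and small loss -/

/-- Towers of mean `m` and loss `α` exist at all large scales, with a uniform constant `C`. -/
def HasTowers (C : ℕ) (m α : ℝ) : Prop :=
  ∀ r, C ≤ r → ∃ f t, IsTower C r m α f t

/-- Like `HasTowers`, where moreover the spikes of height at least `c` have density at least `d`.
The spikes supply additional hits to towers placed in front of them. -/
def HasSpikedTowers (c : ℕ) (d : ℝ) (C : ℕ) (m α : ℝ) : Prop :=
  ∀ r, C ≤ r → ∃ f t, IsTower C r m α f t ∧
    d ≤ 𝔼 x ∈ range (2 ^ r), if c ≤ f x then (1 : ℝ) else 0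

section Towers

variable {C : ℕ} {m α m' α' : ℝ}

lemma HasTowers.mono (h : HasTowers C m α) (hm : m ≤ m') (hα : α ≤ α') : HasTowers C m' α' :=
  fun r hr =>
    let ⟨f, t, hf⟩ := h r hr
    ⟨f, t, hf.mono hm hα⟩

lemma HasSpikedTowers.mono {c : ℕ} {d : ℝ} (h : HasSpikedTowers c d C m α) (hm : m ≤ m')
    (hα : α ≤ α') : HasSpikedTowers c d C m' α' := fun r hr =>
  let ⟨f, t, hf, hd⟩ := h r hr
  ⟨f, t, hf.mono hm hα, hd⟩

lemma HasSpikedTowers.hasTowers {c : ℕ} {d : ℝ} (h : HasSpikedTowers c d C m α) :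
    HasTowers C m α := fun r hr =>
  let ⟨f, t, hf, _⟩ := h r hr
  ⟨f, t, hf⟩

lemma HasTowers.combine {CA CB γ h : ℕ} {d β : ℝ} (hA : HasTowers CA m α)
    (hB : HasSpikedTowers (2 ^ γ) d CB m' β) (hγ : 3 * CA + h + 1 ≤ γ) :
    HasSpikedTowers (2 ^ γ) (d / 2) (3 * (CA + CB) + h + 1) ((m + m') / 2)
      ((Real.exp (-(2 ^ γ * d / 4)) * α + β) / 2 + (1 / 2) ^ h) := by
  intro r hr
  obtain ⟨R, rfl⟩ := Nat.exists_eq_add_of_le' (show 1 ≤ r by omega)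
  obtain ⟨f, t, hf⟩ := hA (R - 2 * CA - h) (by omega)
  obtain ⟨g, s, hg, hd⟩ := hB (R - 2 * CB - h) (by omega)
  refine ⟨_, _, isTower_splice hf hg hd (by omega) (by omega) hγ, ?_⟩
  rw [pow_succ', expect_splice (fun n => if 2 ^ γ ≤ n then (1 : ℝ) else 0) hf.periodic hg.periodic
    (pow_dvd_pow 2 (by omega)) (pow_dvd_pow 2 (by omega)) (by positivity)]
  have : 0 ≤ 𝔼 x ∈ range (2 ^ (R - 2 * CA - h)), if 2 ^ γ ≤ f x then (1 : ℝ) else 0 :=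
    Finset.expect_nonneg fun x _ => by split_ifs <;> norm_num
  linarith

lemma hasTowers_zero : HasTowers 0 0 1 := fun r _ =>
  ⟨0, fun _ => 2 ^ r, fun _ => rfl, fun _ => rfl, by simp, by simp, by simp, by simp,
    Finset.expect_le (by simp) fun x _ => hitLoss_le_one _ _ x⟩

lemma hasSpikedTowers_multiples (γ : ℕ) :
    HasSpikedTowers (2 ^ γ) ((1 / 2) ^ γ) γ 1 1 := by
  intro r hr
  have hper : Function.Periodic (fun x : ℕ => if 2 ^ γ ∣ x then (1 : ℝ) else 0) (2 ^ γ) :=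
    fun x => by simp only [Nat.dvd_add_self_right]
  have hdens : 𝔼 x ∈ range (2 ^ r), (if 2 ^ γ ∣ x then (1 : ℝ) else 0) = (1 / 2) ^ γ :=
    calc 𝔼 x ∈ range (2 ^ r), (if 2 ^ γ ∣ x then (1 : ℝ) else 0)
        = 𝔼 x ∈ range (2 ^ γ), (if 2 ^ γ ∣ x then (1 : ℝ) else 0) := by
          simpa only [zero_add] using
            expect_range_of_periodic hper (pow_dvd_pow 2 hr) (by positivity) 0
      _ = 𝔼 x ∈ range (2 ^ γ), (if x = 0 then (1 : ℝ) else 0) :=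
          Finset.expect_congr rfl fun x hx => by
            simp only [Nat.dvd_iff_mod_eq_zero, Nat.mod_eq_of_lt (Finset.mem_range.1 hx)]
      _ = (1 / 2) ^ γ := by simp [Finset.expect_eq_sum_div_card]
  refine ⟨fun x => if 2 ^ γ ∣ x then 2 ^ γ else 0, fun _ => 2 ^ r,
    ⟨fun x => ?_, fun _ => rfl, fun x => ?_, fun _ => ?_, fun _ => ?_, ?_, ?_⟩, ?_⟩
  · simp only [(Nat.dvd_add_iff_left (pow_dvd_pow 2 hr)).symm]
  · split_ifs <;> simp
  · exact Nat.le_mul_of_pos_left _ (by positivity)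
  · exact Nat.pow_le_pow_right two_pos (by omega)
  · simp only [Nat.cast_ite, Nat.cast_pow, Nat.cast_ofNat, Nat.cast_zero]
    simp_rw [← mul_boole _ ((2 : ℝ) ^ γ)]
    rw [← Finset.mul_expect, hdens, ← mul_pow]
    norm_num
  · exact Finset.expect_le (by simp) fun x _ => hitLoss_le_one _ _ x
  · rw [← hdens]
    refine Finset.expect_le_expect fun x _ => ?_
    split_ifs <;> simp_all

lemma exp_neg_le_one_sub_half {y : ℝ} (h0 : 0 ≤ y) (h1 : y ≤ 1) : Real.exp (-y) ≤ 1 - y / 2 := by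
  rw [Real.exp_neg, inv_le_iff_one_le_mul₀ (Real.exp_pos y)]
  nlinarith [Real.add_one_le_exp y]

lemma HasTowers.exists_iterate {γ h : ℕ} (hα : 0 ≤ α) (hT : HasTowers C m α)
    (hγ : 3 * C + h + 1 ≤ γ) (j : ℕ) :
    ∃ C', HasSpikedTowers (2 ^ γ) ((1 / 2) ^ γ * (1 / 2) ^ j) C'
      ((1 - (1 / 2) ^ j) * m + (1 / 2) ^ j)
      ((1 - (1 / 2) ^ j - j * (1 / 2) ^ j / 8) * α + (1 / 2) ^ j + 2 * (1 / 2) ^ h) := by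
  induction j with
  | zero => exact ⟨γ, by simpa using (hasSpikedTowers_multiples γ).mono le_rfl (by simp)⟩
  | succ j ih =>
    obtain ⟨C', hC'⟩ := ih
    have hspikes : (2 : ℝ) ^ γ * ((1 / 2) ^ γ * (1 / 2) ^ j) / 4 = (1 / 2) ^ j / 4 := by
      rw [← mul_assoc, ← mul_pow]
      norm_num
    have hj : ((1 : ℝ) / 2) ^ j ≤ 1 := pow_le_one₀ (by norm_num) (by norm_num)
    have hgain := mul_le_mul_of_nonneg_right
      (exp_neg_le_one_sub_half (y := (1 / 2) ^ j / 4) (by positivity) (by linarith)) hα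
    have hcombine := hT.combine hC' hγ
    rw [hspikes, mul_div_assoc] at hcombine
    have hhalf : ((1 : ℝ) / 2) ^ (j + 1) = (1 / 2) ^ j / 2 := by rw [pow_succ, mul_one_div]
    rw [hhalf]
    refine ⟨_, hcombine.mono (by linarith) ?_⟩
    push_cast
    linarith

lemma HasTowers.exists_step {n : ℕ} (hα : 0 ≤ α) (hm : 0 ≤ m) (hT : HasTowers C m α) :
    ∃ C', HasTowers C' (m + (1 / 2) ^ n)
      ((1 - n * (1 / 2) ^ n / 8) * α + 2 * (1 / 2) ^ n) := by
  obtain ⟨C', h⟩ := hT.exists_iterate hα (h := n + 1) le_rfl n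
  have hm' : 0 ≤ (1 / 2) ^ n * m := by positivity
  have hα' : 0 ≤ (1 / 2) ^ n * α := by positivity
  exact ⟨C', h.hasTowers.mono (by linarith) (by rw [pow_succ]; linarith)⟩

lemma two_pow_mul_half_pow (n : ℕ) : (2 : ℝ) ^ n * (1 / 2) ^ n = 1 := by
  rw [← mul_pow]
  norm_num

lemma nat_mul_half_pow_le_one (n : ℕ) : (n : ℝ) * (1 / 2) ^ n ≤ 1 := by
  refine le_of_le_of_eq ?_ (two_pow_mul_half_pow n)
  gcongr
  exact_mod_cast Nat.lt_two_pow_self.le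

lemma exists_hasTowers_level {n : ℕ} (hn : 0 < n) (l : ℕ) :
    ∃ C, HasTowers C (l * (1 / 2) ^ n) ((1 - n * (1 / 2) ^ n / 8) ^ l + 16 / n) := by
  induction l with
  | zero => exact ⟨0, hasTowers_zero.mono (by simp)
      (by rw [pow_zero]; exact le_add_of_nonneg_right (by positivity))⟩
  | succ l ih =>
    obtain ⟨C, hC⟩ := ih
    have hfactor : (0 : ℝ) ≤ 1 - n * (1 / 2) ^ n / 8 := by linarith [nat_mul_half_pow_le_one n]
    obtain ⟨C', h⟩ := hC.exists_step (n := n)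
      (add_nonneg (pow_nonneg hfactor l) (by positivity)) (by positivity)
    refine ⟨C', h.mono (by push_cast; linarith) (le_of_eq ?_)⟩
    field_simp
    ring

lemma one_sub_pow_two_pow_le {n : ℕ} (hn : 0 < n) :
    (1 - n * (1 / 2) ^ n / 8 : ℝ) ^ 2 ^ n ≤ 8 / n := by
  calc (1 - n * (1 / 2) ^ n / 8 : ℝ) ^ 2 ^ n
      ≤ Real.exp (-(n * (1 / 2) ^ n / 8)) ^ 2 ^ n := by
        gcongr
        · linarith [nat_mul_half_pow_le_one n]
        · exact Real.one_sub_le_exp_neg _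
    _ = (Real.exp (n / 8))⁻¹ := by
        rw [← Real.exp_nat_mul, ← Real.exp_neg]
        push_cast
        congr 1
        linear_combination (-(n : ℝ) / 8) * two_pow_mul_half_pow n
    _ ≤ (n / 8 : ℝ)⁻¹ := by
        gcongr
        linarith [Real.add_one_le_exp ((n : ℝ) / 8)]
    _ = 8 / n := inv_div _ _

lemma exists_hasTowers_mean_one {ε : ℝ} (hε : 0 < ε) : ∃ C, HasTowers C 1 ε := by
  obtain ⟨n, hn⟩ := exists_nat_gt (24 / ε)
  have hn0 : (0 : ℝ) < n := lt_trans (by positivity) hn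
  obtain ⟨C, h⟩ := exists_hasTowers_level (Nat.cast_pos.1 hn0) (2 ^ n)
  refine ⟨C, h.mono (by exact_mod_cast (two_pow_mul_half_pow n).le) ?_⟩
  calc (1 - n * (1 / 2) ^ n / 8 : ℝ) ^ 2 ^ n + 16 / n ≤ 8 / n + 16 / n := by
        gcongr
        exact one_sub_pow_two_pow_le (Nat.cast_pos.1 hn0)
    _ = 24 / n := by ring
    _ ≤ ε := (div_le_comm₀ hn0 hε).2 hn.le

end Towers

lemma le_countMax_of_hitLoss_le {f t : ℕ → ℕ} {x K : ℕ} (ht : 0 < t x)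
    (hfin : (hitTimesFrom f x (t x)).Finite) (h : hitLoss f t x ≤ Real.exp (-K)) :
    (K : ℝ≥0∞) ≤ countMax fun n => f (x + n) := by
  rw [hitLoss, Real.exp_le_exp, neg_le_neg_iff, le_div_iff₀ (by exact_mod_cast ht)] at h
  have hcount : (K * t x : ℕ∞) ≤ (hitTimesFrom f x (t x)).encard := by
    rw [← hfin.cast_ncard_eq]
    exact_mod_cast h
  refine le_trans ?_ (le_iSup _ (t x))
  rw [ENNReal.le_div_iff_mul_le (by simp [ht.ne']) (by simp)]
  exact_mod_cast hcount

lemma exists_periodic_le_countMax (K : ℕ) :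
    ∃ (P : ℕ) (f : ℕ → ℕ), 0 < P ∧ Function.Periodic f P ∧ 𝔼 x ∈ range P, (f x : ℝ) ≤ 1 ∧
      1 / 2 ≤ 𝔼 x ∈ range P, if (K : ℝ≥0∞) ≤ countMax (fun n => f (x + n)) then (1 : ℝ) else 0 := by
  obtain ⟨C, hC⟩ := exists_hasTowers_mean_one (ε := Real.exp (-K) / 2) (by positivity)
  obtain ⟨f, t, hf⟩ := hC C le_rfl
  refine ⟨2 ^ C, f, by positivity, hf.periodic, hf.mean_le, ?_⟩
  have hmarkov : ∀ x, 1 - Real.exp K * hitLoss f t x ≤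
      if (K : ℝ≥0∞) ≤ countMax (fun n => f (x + n)) then 1 else 0 := fun x => by
    split_ifs with hx
    · exact sub_le_self 1 (mul_pos (Real.exp_pos _) (Real.exp_pos _)).le
    · have hloss := not_le.1 fun h =>
        hx (le_countMax_of_hitLoss_le (hf.time_pos x) (hitTimesFrom_finite hf.le_pow x _) h)
      rw [Real.exp_neg, inv_lt_iff_one_lt_mul₀' (Real.exp_pos _)] at hloss
      linarith
  calc (1 : ℝ) / 2 = 1 - Real.exp K * (Real.exp (-K) / 2) := by
        rw [Real.exp_neg, ← mul_div_assoc, mul_inv_cancel₀ (Real.exp_ne_zero _)]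
        norm_num
    _ ≤ 1 - Real.exp K * 𝔼 x ∈ range (2 ^ C), hitLoss f t x := by
        gcongr
        exact hf.loss_le
    _ = 𝔼 x ∈ range (2 ^ C), (1 - Real.exp K * hitLoss f t x) := by
        rw [Finset.expect_sub_distrib, ← Finset.mul_expect, Finset.expect_const (by simp)]
    _ ≤ _ := Finset.expect_le_expect fun x _ => hmarkov x

/-! ### Bernoulli shifts -/

lemma ae_frequently_mem_of_tsum_eq_top {ι : Type*} {Ω : ι → Type*} [∀ i, MeasurableSpace (Ω i)]
    (μ : ∀ i, Measure (Ω i)) [∀ i, IsProbabilityMeasure (μ i)] {e : ℕ → ι} (he : e.Injective)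
    {E : ∀ n, Set (Ω (e n))} (hE : ∀ n, MeasurableSet (E n)) (hsum : ∑' n, μ (e n) (E n) = ∞) :
    ∀ᵐ x ∂Measure.infinitePi μ, ∃ᶠ n in atTop, x (e n) ∈ E n := by
  set s : ℕ → Set (∀ i, Ω i) := fun n => (fun x => x (e n)) ⁻¹' E n
  have hs : ∀ n, MeasurableSet (s n) := fun n => measurable_pi_apply (e n) (hE n)
  have hindep : ProbabilityTheory.iIndepSet s (Measure.infinitePi μ) :=
    (ProbabilityTheory.iIndepSet_iff_meas_biInter hs).2 fun I =>
      ((ProbabilityTheory.iIndepFun_infinitePi (P := μ) fun _ => measurable_id).precomp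
        he).meas_biInter fun n _ => ⟨E n, hE n, rfl⟩
  have hone : Measure.infinitePi μ (limsup s atTop) = 1 :=
    ProbabilityTheory.measure_limsup_eq_one hs hindep <| hsum ▸ tsum_congr fun n =>
      (measurePreserving_eval_infinitePi μ (e n)).measure_preimage (hE n).nullMeasurableSet
  filter_upwards [(mem_ae_iff_prob_eq_one (.measurableSet_limsup hs)).2 hone] with x hx
  exact mem_limsup_iff_frequently_mem.1 hx

lemma exists_integrable_forall_le {Ω : Type*} [MeasurableSpace Ω] {μ : Measure Ω}
    {u : ℕ → Ω → ℝ} (hu : ∀ j, Measurable (u j))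
    (hsum : ∑' j, ∫⁻ ω, ENNReal.ofReal (u j ω) ∂μ ≠ ∞) :
    ∃ F : Ω → ℝ, Measurable F ∧ Integrable F μ ∧ ∀ᵐ ω ∂μ, ∀ j, u j ω ≤ F ω := by
  have hmeas : Measurable fun ω => ∑' j, ENNReal.ofReal (u j ω) :=
    Measurable.tsum fun j => (hu j).ennreal_ofReal
  rw [← lintegral_tsum fun j => (hu j).ennreal_ofReal.aemeasurable] at hsum
  refine ⟨_, hmeas.ennreal_toReal,
    integrable_toReal_of_lintegral_ne_top hmeas.aemeasurable hsum, ?_⟩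
  filter_upwards [ae_lt_top hmeas hsum] with ω hω j
  exact (ENNReal.ofReal_le_iff_le_toReal hω.ne).1 (ENNReal.le_tsum j)

lemma tsum_ne_top_of_le_half_pow {u : ℕ → ℝ≥0∞} (hu : ∀ j, u j ≤ ENNReal.ofReal ((1 / 2) ^ j)) :
    ∑' j, u j ≠ ∞ :=
  ne_top_of_le_ne_top (summable_geometric_two.tsum_ofReal_ne_top) (ENNReal.tsum_le_tsum hu)

lemma exists_integrable_le_volume {c : ℕ → ℝ} (hc : ∀ j, 1 ≤ c j) :
    ∃ g : unitInterval → ℝ, Measurable g ∧ Integrable g ∧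
      ∀ j, ENNReal.ofReal ((2 ^ j * c j)⁻¹) ≤ volume {u | c j ≤ g u} := by
  have hc0 : ∀ j, 0 < c j := fun j => one_pos.trans_le (hc j)
  have hp : ∀ j, (2 ^ j * c j)⁻¹ ∈ unitInterval := fun j =>
    ⟨inv_nonneg.2 (mul_nonneg (by positivity) (hc0 j).le), inv_le_one_of_one_le₀
      (one_le_mul_of_one_le_of_one_le (one_le_pow₀ one_le_two) (hc j))⟩
  set p : ℕ → unitInterval := fun j => ⟨(2 ^ j * c j)⁻¹, hp j⟩
  have hvol : ∀ j, volume (Set.Iic (p j)) = ENNReal.ofReal ((2 ^ j * c j)⁻¹) := fun j => by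
    rw [unitInterval.volume_Iic]
  obtain ⟨g, hg, hgi, hdom⟩ := exists_integrable_forall_le (μ := (volume : Measure unitInterval))
    (u := fun j => (Set.Iic (p j)).indicator fun _ => c j)
    (fun j => measurable_const.indicator measurableSet_Iic)
    (tsum_ne_top_of_le_half_pow fun j => by
      rw [Set.comp_indicator_const (c j) ENNReal.ofReal ENNReal.ofReal_zero,
        lintegral_indicator_const measurableSet_Iic, hvol, ← ENNReal.ofReal_mul (hc0 j).le,
        mul_inv_rev, mul_inv_cancel_left₀ (hc0 j).ne', one_div, inv_pow])
  refine ⟨g, hg, hgi, fun j => (hvol j).symm.trans_le (measure_mono_ae ?_)⟩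
  filter_upwards [hdom] with u hu (hmem : u ∈ Set.Iic (p j))
  exact (Set.indicator_of_mem hmem fun _ => c j).symm.trans_le (hu j)

lemma exists_integrable_tsum_volume_eq_top {a : ℕ → ℝ} (ha : countMax a = ∞) :
    ∃ g : unitInterval → ℝ, Measurable g ∧ Integrable g ∧
      ∑' n : ℕ, volume {u | 1 ≤ n ∧ n ≤ a n * g u} = ∞ := by
  have hscale : ∀ j : ℕ, ∃ t : ℕ, 0 < t ∧ ENNReal.ofReal (4 ^ j) * t ≤ (hitTimes a t).encard :=
    fun j => exists_mul_le_encard_hitTimes (ha ▸ ENNReal.ofReal_lt_top)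
  choose t ht hcount using hscale
  obtain ⟨g, hg, hgi, htail⟩ := exists_integrable_le_volume (c := fun j => t j)
    fun j => by exact_mod_cast ht j
  have hhit : ∀ j, ∀ n ∈ hitTimes a (t j),
      {u | (t j : ℝ) ≤ g u} ⊆ {u | 1 ≤ n ∧ n ≤ a n * g u} := fun j n hn u hu => by
    have hn0 : (0 : ℝ) < n := by exact_mod_cast hn.1
    have hapos : 0 < a n := pos_of_mul_pos_right (hn0.trans_le hn.2) (t j).cast_nonneg
    refine ⟨hn.1, hn.2.trans ?_⟩
    rw [mul_comm]
    exact mul_le_mul_of_nonneg_left hu hapos.le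
  have hlower : ∀ j : ℕ,
      ENNReal.ofReal (2 ^ j) ≤ ∑' n : ℕ, volume {u | 1 ≤ n ∧ n ≤ a n * g u} := fun j =>
    calc ENNReal.ofReal (2 ^ j)
        = ENNReal.ofReal (4 ^ j) * t j * ENNReal.ofReal ((2 ^ j * t j)⁻¹) := by
          have ht0 : (t j : ℝ) ≠ 0 := by exact_mod_cast (ht j).ne'
          rw [← ENNReal.ofReal_natCast, ← ENNReal.ofReal_mul (by positivity),
            ← ENNReal.ofReal_mul (by positivity), mul_inv_rev, ← mul_assoc,
            mul_inv_cancel_right₀ ht0, ← div_eq_mul_inv, ← div_pow]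
          norm_num
      _ ≤ (hitTimes a (t j)).encard * ENNReal.ofReal ((2 ^ j * t j)⁻¹) := by
          gcongr
          exact hcount j
      _ = ∑' _ : hitTimes a (t j), ENNReal.ofReal ((2 ^ j * t j)⁻¹) :=
          (ENNReal.tsum_set_const _ _).symm
      _ ≤ ∑' n : hitTimes a (t j), volume {u | 1 ≤ (n : ℕ) ∧ (n : ℕ) ≤ a n * g u} :=
          ENNReal.tsum_le_tsum fun n => (htail j).trans (measure_mono (hhit j n n.2))
      _ ≤ ∑' n : ℕ, volume {u | 1 ≤ n ∧ n ≤ a n * g u} :=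
          ENNReal.tsum_comp_le_tsum_of_injective Subtype.val_injective _
  have htop := ENNReal.tendsto_ofReal_atTop.comp
    (tendsto_pow_atTop_atTop_of_one_lt (one_lt_two (α := ℝ)))
  exact ⟨g, hg, hgi, top_unique (le_of_tendsto' htop hlower)⟩

/-- The left shift on two-sided sequences. -/
def shiftEquiv (Ω : Type*) [MeasurableSpace Ω] : (ℤ → Ω) ≃ᵐ (ℤ → Ω) :=
  MeasurableEquiv.arrowCongr' (Equiv.subRight 1) (MeasurableEquiv.refl Ω)

lemma shiftEquiv_iterate {Ω : Type*} [MeasurableSpace Ω] (n : ℕ) (y : ℤ → Ω) (i : ℤ) :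
    (shiftEquiv Ω)^[n] y i = y (i + n) := by
  induction n generalizing y with
  | zero => simp
  | succ n ih =>
    rw [Function.iterate_succ_apply, ih, Nat.cast_succ, ← add_assoc]
    rfl

lemma measurePreserving_shiftEquiv {Ω : Type*} [MeasurableSpace Ω] (μ : Measure Ω)
    [IsProbabilityMeasure μ] :
    MeasurePreserving (shiftEquiv Ω) (Measure.infinitePi fun _ : ℤ => μ)
      (Measure.infinitePi fun _ : ℤ => μ) :=
  ⟨(shiftEquiv Ω).measurable,
    Measure.map_infinitePi_infinitePi_of_inj (P := fun _ : ℤ => μ) (add_left_injective 1)⟩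

lemma not_tendsto_div_zero_of_frequently {a : ℕ → ℝ} (h : ∃ᶠ n : ℕ in atTop, 1 ≤ n ∧ n ≤ a n) :
    ¬ Tendsto (fun n : ℕ => a n / n) atTop (𝓝 0) := fun hlim => by
  obtain ⟨n, ⟨hn, hle⟩, hlt⟩ := (h.and_eventually (hlim.eventually (gt_mem_nhds one_pos))).exists
  rw [div_lt_one (by exact_mod_cast hn)] at hlt
  exact hlt.not_ge hle

lemma exists_not_tendsto_of_countMax_eq_top {a : ℕ → ℝ} (ha : countMax a = ∞) :
    ∃ (Y : Type) (_ : MeasurableSpace Y) (ν : Measure Y) (_ : IsProbabilityMeasure ν)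
      (S : Y ≃ᵐ Y) (g : Y → ℝ), MeasurePreserving S ν ν ∧ Integrable g ν ∧
        ∀ᵐ y ∂ν, ¬ Tendsto (fun n : ℕ => a n * g (S^[n] y) / n) atTop (𝓝 0) := by
  obtain ⟨g, hg, hgi, hsum⟩ := exists_integrable_tsum_volume_eq_top ha
  refine ⟨ℤ → unitInterval, inferInstance, Measure.infinitePi fun _ => volume, inferInstance,
    shiftEquiv unitInterval, fun y => g (y 0), measurePreserving_shiftEquiv volume,
    (measurePreserving_eval_infinitePi (fun _ : ℤ => volume) 0).integrable_comp_of_integrable hgi,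
    ?_⟩
  have hfreq := ae_frequently_mem_of_tsum_eq_top (fun _ : ℤ => (volume : Measure unitInterval))
    Nat.cast_injective (fun n =>
      (MeasurableSet.const (1 ≤ n)).inter
        (measurableSet_le measurable_const (measurable_const.mul hg))) hsum
  filter_upwards [hfreq] with y hy
  simp only [shiftEquiv_iterate, zero_add]
  exact not_tendsto_div_zero_of_frequently hy

/-! ### Products of cyclic rotations -/

/-- The simultaneous rotation by `1` of a sequence of cyclic groups. -/
def cyclicRotation (P : ℕ → ℕ) [∀ m, NeZero (P m)] : (∀ m, Fin (P m)) ≃ᵐ (∀ m, Fin (P m)) :=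
  MeasurableEquiv.addRight 1

/-- The uniform probability measure on a product of cyclic groups. -/
noncomputable abbrev cyclicProb (P : ℕ → ℕ) [∀ m, NeZero (P m)] : Measure (∀ m, Fin (P m)) :=
  Measure.infinitePi fun _ => uniformOn Set.univ

lemma lintegral_uniformOn_univ_fin (P : ℕ) {φ : ℕ → ℝ} (hφ : ∀ i, 0 ≤ φ i) :
    ∫⁻ i : Fin P, ENNReal.ofReal (φ i) ∂uniformOn Set.univ =
      ENNReal.ofReal (𝔼 i ∈ range P, φ i) := by
  rcases P.eq_zero_or_pos with rfl | hP
  · simp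
  rw [uniformOn, ProbabilityTheory.cond, Measure.restrict_univ, lintegral_smul_measure,
    lintegral_count, tsum_fintype, Fin.sum_univ_eq_sum_range (fun i => ENNReal.ofReal (φ i)),
    ← ENNReal.ofReal_sum_of_nonneg fun i _ => hφ i, Finset.expect_eq_sum_div_card,
    Finset.card_range, ENNReal.ofReal_div_of_pos (by exact_mod_cast hP)]
  simp [ENNReal.div_eq_inv_mul]

lemma measurePreserving_cyclicRotation (P : ℕ → ℕ) [∀ m, NeZero (P m)] :
    MeasurePreserving (cyclicRotation P) (cyclicProb P) (cyclicProb P) := by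
  refine ⟨(cyclicRotation P).measurable, ?_⟩
  have hcoord : ∀ m, (uniformOn Set.univ : Measure (Fin (P m))).map (fun i => i + 1) =
      uniformOn Set.univ := fun m => by
    rw [uniformOn, ProbabilityTheory.cond, Measure.restrict_univ, Measure.map_smul,
      map_add_right_eq_self]
  have h := Measure.infinitePi_map_pi (fun m => (uniformOn Set.univ : Measure (Fin (P m))))
    (f := fun m i => i + 1) fun m => measurable_from_top
  simp only [hcoord] at h
  exact h

lemma cyclicRotation_iterate_val (P : ℕ → ℕ) [∀ m, NeZero (P m)] (n m : ℕ)
    (x : ∀ m, Fin (P m)) : ((cyclicRotation P)^[n] x m : ℕ) = (x m + n) % P m := by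
  induction n with
  | zero => simp [Nat.mod_eq_of_lt]
  | succ n ih =>
    rw [Function.iterate_succ_apply']
    change (((cyclicRotation P)^[n] x m + 1 : Fin (P m)) : ℕ) = _
    rw [Fin.val_add, ih, Fin.val_one', ← Nat.add_mod, add_assoc]

lemma lintegral_cyclicProb_eval (P : ℕ → ℕ) [∀ m, NeZero (P m)] (m : ℕ) {φ : ℕ → ℝ}
    (hφ : ∀ i, 0 ≤ φ i) :
    ∫⁻ x, ENNReal.ofReal (φ (x m)) ∂cyclicProb P = ENNReal.ofReal (𝔼 i ∈ range (P m), φ i) := by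
  rw [← lintegral_uniformOn_univ_fin (P m) hφ]
  exact (measurePreserving_eval_infinitePi (fun m => uniformOn (Set.univ : Set (Fin (P m)))) m)
    |>.lintegral_comp
    (f := fun i : Fin (P m) => ENNReal.ofReal (φ i)) measurable_from_top

lemma exists_integrable_forall_le_two_pow_mul {P : ℕ → ℕ} [∀ m, NeZero (P m)] {f : ℕ → ℕ → ℕ}
    (hper : ∀ m, Function.Periodic (f m) (P m))
    (hmean : ∀ m, 𝔼 i ∈ range (P m), (f m i : ℝ) ≤ 1) :
    ∃ F : (∀ m, Fin (P m)) → ℝ, Integrable F (cyclicProb P) ∧ ∀ᵐ x ∂cyclicProb P, ∀ n m : ℕ,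
      (f m (x m + n) : ℝ) ≤ (2 ^ m : ℕ) * F ((cyclicRotation P)^[n] x) := by
  obtain ⟨F, -, hF, hdom⟩ := exists_integrable_forall_le (μ := cyclicProb P)
    (u := fun m x => (1 / 2) ^ m * f m (x m))
    (fun m => (measurable_from_top (f := fun i : Fin (P m) => (1 / 2 : ℝ) ^ m * f m i)).comp
      (measurable_pi_apply m))
    (tsum_ne_top_of_le_half_pow fun m => by
      rw [lintegral_cyclicProb_eval P m (φ := fun i => (1 / 2) ^ m * f m i)
        fun i => by positivity, ← Finset.mul_expect]
      exact ENNReal.ofReal_le_ofReal (mul_le_of_le_one_right (by positivity) (hmean m)))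
  refine ⟨F, hF, ae_all_iff.2 fun n => ?_⟩
  filter_upwards [((measurePreserving_cyclicRotation P).iterate n).quasiMeasurePreserving.ae hdom]
    with x hx m
  have hle := hx m
  rw [cyclicRotation_iterate_val, (hper m).map_mod_nat, one_div, inv_pow,
    inv_mul_le_iff₀ (by positivity)] at hle
  exact_mod_cast hle

lemma ae_frequently_cyclicProb {P : ℕ → ℕ} [∀ m, NeZero (P m)] {p : ℕ → ℕ → Prop}
    [∀ m, DecidablePred (p m)] {c : ℝ} (hc : 0 < c)
    (hp : ∀ m, c ≤ 𝔼 i ∈ range (P m), if p m i then (1 : ℝ) else 0) :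
    ∀ᵐ x ∂cyclicProb P, ∃ᶠ m in atTop, p m (x m) := by
  have hmeas : ∀ m, ENNReal.ofReal c ≤ uniformOn Set.univ {i : Fin (P m) | p m i} := fun m => by
    rw [← lintegral_indicator_one .of_discrete]
    calc ENNReal.ofReal c ≤ ENNReal.ofReal (𝔼 i ∈ range (P m), if p m i then (1 : ℝ) else 0) :=
          ENNReal.ofReal_le_ofReal (hp m)
      _ = ∫⁻ i : Fin (P m), ENNReal.ofReal (if p m i then 1 else 0) ∂uniformOn Set.univ :=
          (lintegral_uniformOn_univ_fin (P m) fun i => by split_ifs <;> norm_num).symm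
      _ = _ := lintegral_congr fun i => by
          by_cases hi : p m i <;> simp [hi]
  refine ae_frequently_mem_of_tsum_eq_top (fun m => uniformOn (Set.univ : Set (Fin (P m))))
    Function.injective_id (E := fun m => {i | p m i}) (fun _ => .of_discrete)
    (top_unique ?_)
  calc ∞ = ∑' _ : ℕ, ENNReal.ofReal c :=
        (ENNReal.tsum_const_eq_top_of_ne_zero (ENNReal.ofReal_pos.2 hc).ne').symm
    _ ≤ _ := ENNReal.tsum_le_tsum hmeas

lemma exists_integrable_ae_countMax_eq_top :
    ∃ (X : Type) (_ : MeasurableSpace X) (μ : Measure X) (_ : IsProbabilityMeasure μ)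
      (T : X ≃ᵐ X) (F : X → ℝ), MeasurePreserving T μ μ ∧ Integrable F μ ∧
        ∀ᵐ x ∂μ, countMax (fun n => F (T^[n] x)) = ∞ := by
  choose P f hP hper hmean hcount using fun m => exists_periodic_le_countMax (2 ^ m * m)
  have : ∀ m, NeZero (P m) := fun m => ⟨(hP m).ne'⟩
  obtain ⟨F, hF, hdom⟩ := exists_integrable_forall_le_two_pow_mul hper hmean
  refine ⟨∀ m, Fin (P m), inferInstance, cyclicProb P, inferInstance, cyclicRotation P, F,
    measurePreserving_cyclicRotation P, hF, ?_⟩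
  filter_upwards [hdom, ae_frequently_cyclicProb one_half_pos hcount] with x hx hfreq
  have hlower : ∃ᶠ m : ℕ in atTop, (m : ℝ≥0∞) ≤ countMax fun n => F ((cyclicRotation P)^[n] x) :=
    hfreq.mono fun m hm => by
      have hle := hm.trans (countMax_le_mul (by positivity) fun n => hx n m)
      rw [Nat.cast_mul] at hle
      exact (ENNReal.mul_le_mul_iff_right (by simp) (by simp)).1 hle
  exact top_unique (le_of_tendsto_of_frequently ENNReal.tendsto_nat_nhds_top hlower)

theorem theorem2 :
    ∃ (X : Type) (_ : MeasurableSpace X) (μ : Measure X) (_ : IsProbabilityMeasure μ)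
      (T : X ≃ᵐ X), MeasurePreserving T μ μ ∧ ¬ ReturnTimesForTheTail μ T 1 := by
  obtain ⟨X, _, μ, _, T, F, hT, hF, htop⟩ := exists_integrable_ae_countMax_eq_top
  refine ⟨X, _, μ, ‹_›, T, hT, fun hRT => ?_⟩
  obtain ⟨x, hx, hxtop⟩ := ((hRT F (memLp_one_iff_integrable.2 hF)).and htop).exists
  obtain ⟨Y, _, ν, _, S, g, hS, hg, hnot⟩ := exists_not_tendsto_of_countMax_eq_top hxtop
  obtain ⟨y, hy, hny⟩ := ((hx Y ν S hS g hg).and hnot).exists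
  exact hny hy
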